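/- Let $n>1$ be an integer. For a measurable function $f$ on $\mathbb{R}^n$ let $f^*(t)=\inf\{s\ge 0:\ |\{x:|f(x)|>s\}|\le t\}$ be its decreasing rearrangement with respect to Lebesgue measure, and let $f^{**}(t)=\frac1t\int_0^t f^*(s)\,ds$ for $t>0$. For $1\le q\le\infty$ put $$\|f\|_{L(p,q)}=\Big\{\int_0^\infty \big(f^*(t)\,t^{1/p}\big)^q\,\frac{dt}{t}\Big\}^{1/q}\quad(1\le p<\infty),\qquad \|f\|_{L(\infty,q)}=\Big\{\int_0^\infty \big(f^{**}(t)-f^*(t)\big)^q\,\frac{dt}{t}\Big\}^{1/q},$$ where for $q=\infty$ the expression $\{\int_0^\infty g(t)^q\,\frac{dt}{t}\}^{1/q}$ is read as $\sup_{t>0}g(t)$. Let $1\le p\le n$ and $1\le q\le\infty$, and define $\bar p\in[1,\infty]$ by $\frac1{\bar p}=\frac1p-\frac1n$ (so $\bar p=\infty$ if $p=n$). If $1<p\le n$ (with any $q\in[1,\infty]$), or if $p=q=1$, then there is a finite constant $c_n(p,q)$, depending only on $n$, $p$ and $q$, such that $$\|f\|_{L(\bar p,q)}\le c_n(p,q)\,\big\|\,|\nabla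 f|\,\big\|_{L(p,q)}$$ for every real-valued $f\in C_0^\infty(\mathbb{R}^n)$, that is, every infinitely differentiable function with compact support. -/

import Mathlib

open MeasureTheory
open scoped ENNReal NNReal

/-- The decreasing rearrangement
`f*(t) = inf {s ≥ 0 : μ {x : |f x| > s} ≤ t}` of `f`, for `t ≥ 0`. -/
noncomputable def rearrangement {α E : Type*} [MeasurableSpace α] [NormedAddCommGroup E]
    (μ : Measure α) (f : α → E) (t : ℝ) : ℝ≥0∞ :=
  sInf {s : ℝ≥0∞ | μ {x | s < ‖f x‖ₑ} ≤ ENNReal.ofReal t}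

/-- The maximal average `f**(t) = (1 / t) ∫_0^t f*(s) ds` of the decreasing rearrangement,
for `t > 0`. -/
noncomputable def maximalRearrangement {α E : Type*} [MeasurableSpace α] [NormedAddCommGroup E]
    (μ : Measure α) (f : α → E) (t : ℝ) : ℝ≥0∞ :=
  (∫⁻ s in Set.Ioo 0 t, rearrangement μ f s) / ENNReal.ofReal t

/-- The norm `{∫_0^∞ g(t)^q dt/t}^{1/q}` of a nonnegative function `g` on the half-line
`(0, ∞)`, with the usual modification `sup_{t > 0} g(t)` for `q = ∞`. -/
noncomputable def haarNorm (q : ℝ≥0∞) (g : ℝ → ℝ≥0∞) : ℝ≥0∞ :=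
  if q = ∞ then ⨆ t ∈ Set.Ioi (0 : ℝ), g t
  else (∫⁻ t in Set.Ioi (0 : ℝ), g t ^ q.toReal / ENNReal.ofReal t) ^ (1 / q.toReal)

/-- The Lorentz quantity `‖f‖_{L(p,q)}`, with values in `[0, ∞]`. For `p < ∞` it is built from
`f*(t) t^{1/p}`, and for `p = ∞` from the oscillation `f**(t) - f*(t)` (which is nonnegative
since `f*` is nonincreasing). -/
noncomputable def lorentzNorm {α E : Type*} [MeasurableSpace α] [NormedAddCommGroup E]
    (p q : ℝ≥0∞) (μ : Measure α) (f : α → E) : ℝ≥0∞ :=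
  if p = ∞ then haarNorm q fun t => maximalRearrangement μ f t - rearrangement μ f t
  else haarNorm q fun t => rearrangement μ f t * ENNReal.ofReal t ^ (1 / p.toReal)

/-! Everything follows from one estimate for the increments of `f*`. Applying the
Gagliardo–Nirenberg–Sobolev inequality with exponent 1 to a smooth truncation of `f` between two
levels, then choosing the levels `f*(t)` and `f*(s)`, bounds `(f*(s) - f*(t)) s^{1-1/n}` by the
integral of `|∇f|` over the layer `f*(t) < |f| < f*(s)` (`exists_const_rearrangement_sub_le`). For
`s = t/2` the layer has measure at most `t`, so Hardy–Littlewood gives `f*(t/2) - f*(t) ≤ C t^{1/n}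
|∇f|**(t)`.

It remains to compare norms. A quantity that is at most a factor `a < 1` times a dilate of itself
plus an error is controlled by the error, since `dt/t` is dilation invariant
(`haarNorm_le_of_le_dilate_add`). This principle yields Hardy's inequality, which replaces `|∇f|**`
by `|∇f|*` when `p > 1`; it recovers `f*` from its dyadic increments when `p < n`, and `f** - f*`
from them when `p = n`.

For `p = q = 1` Hardy's inequality fails. There the layer estimate is integrated directly in `dt/t`:
by Tonelli, each point `x` is counted with total mass at most 1. -/

/-- The multiplicative Haar measure `dt / t` on the half-line `(0, ∞)`. -/
noncomputable def halfLineHaar : Measure ℝ :=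
  (volume.restrict (Set.Ioi (0 : ℝ))).withDensity fun t => (ENNReal.ofReal t)⁻¹

theorem lintegral_halfLineHaar {g : ℝ → ℝ≥0∞} (hg : Measurable g) :
    ∫⁻ t, g t ∂halfLineHaar = ∫⁻ t in Set.Ioi (0 : ℝ), g t / ENNReal.ofReal t := by
  rw [halfLineHaar, lintegral_withDensity_eq_lintegral_mul _ (by fun_prop) hg]
  refine lintegral_congr fun t => ?_
  simp [div_eq_mul_inv, mul_comm]

theorem lintegral_halfLineHaar_comp_mul {g : ℝ → ℝ≥0∞} (hg : Measurable g) {c : ℝ} (hc : 0 < c) :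
    ∫⁻ t, g (c * t) ∂halfLineHaar = ∫⁻ t, g t ∂halfLineHaar := by
  rw [lintegral_halfLineHaar hg, lintegral_halfLineHaar (by fun_prop),
    ← lintegral_indicator measurableSet_Ioi, ← lintegral_indicator measurableSet_Ioi]
  have hF : Measurable ((Set.Ioi (0 : ℝ)).indicator fun t => g t / ENNReal.ofReal t) :=
    Measurable.indicator (by fun_prop) measurableSet_Ioi
  have h1 := lintegral_map (μ := volume) hF (measurable_const_mul c)
  rw [Real.map_volume_mul_left hc.ne', lintegral_smul_measure, abs_of_pos (inv_pos.2 hc)] at h1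
  have hc0 : ENNReal.ofReal c ≠ 0 := by simpa using hc
  have h2 : ∀ t : ℝ, (Set.Ioi (0 : ℝ)).indicator (fun t => g (c * t) / ENNReal.ofReal t) t
      = ENNReal.ofReal c * (Set.Ioi (0 : ℝ)).indicator (fun t => g t / ENNReal.ofReal t) (c * t) := by
    intro t
    by_cases ht : 0 < t
    · have hct : 0 < c * t := mul_pos hc ht
      rw [Set.indicator_of_mem (Set.mem_Ioi.2 ht), Set.indicator_of_mem (Set.mem_Ioi.2 hct),
        ENNReal.ofReal_mul hc.le, div_eq_mul_inv, div_eq_mul_inv,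
        ENNReal.mul_inv (Or.inl hc0) (Or.inl ENNReal.ofReal_ne_top), ← mul_assoc, ← mul_assoc,
        mul_comm (ENNReal.ofReal c), mul_assoc (g _), ENNReal.mul_inv_cancel hc0 ENNReal.ofReal_ne_top,
        mul_one]
    · have hct : ¬ 0 < c * t := by
        rw [mul_pos_iff_of_pos_left hc]; exact ht
      rw [Set.indicator_of_notMem (by simpa using ht), Set.indicator_of_notMem (by simpa using hct), mul_zero]
  rw [lintegral_congr h2, lintegral_const_mul' _ _ ENNReal.ofReal_ne_top, ← h1,
    smul_eq_mul, ← mul_assoc, ENNReal.ofReal_inv_of_pos hc,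
    ENNReal.mul_inv_cancel hc0 ENNReal.ofReal_ne_top, one_mul]

/-! ### Norms with respect to `dt/t` and absorption under dilations. -/

theorem haarNorm_top (g : ℝ → ℝ≥0∞) : haarNorm ∞ g = ⨆ t ∈ Set.Ioi (0 : ℝ), g t := by
  simp [haarNorm]

theorem haarNorm_of_ne_top {q : ℝ≥0∞} (hq : q ≠ ∞) {g : ℝ → ℝ≥0∞} (hg : Measurable g) :
    haarNorm q g = (∫⁻ t, g t ^ q.toReal ∂halfLineHaar) ^ (1 / q.toReal) := by
  rw [haarNorm, if_neg hq, lintegral_halfLineHaar (by fun_prop)]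

theorem haarNorm_mono {q : ℝ≥0∞} {g h : ℝ → ℝ≥0∞} (hgh : ∀ t, 0 < t → g t ≤ h t) :
    haarNorm q g ≤ haarNorm q h := by
  unfold haarNorm
  split_ifs
  · exact iSup₂_mono hgh
  · refine ENNReal.rpow_le_rpow (setLIntegral_mono' measurableSet_Ioi fun t ht => ?_) (by positivity)
    exact ENNReal.div_le_div_right (ENNReal.rpow_le_rpow (hgh t ht) (by positivity)) _

theorem haarNorm_const_mul {q : ℝ≥0∞} (hq : 1 ≤ q) {g : ℝ → ℝ≥0∞} (hg : Measurable g) (c : ℝ≥0∞) :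
    haarNorm q (fun t => c * g t) = c * haarNorm q g := by
  by_cases hqt : q = ∞
  · subst hqt
    simp only [haarNorm_top, ENNReal.mul_iSup]
  · have hq0 : 0 < q.toReal := ENNReal.toReal_pos (one_pos.trans_le hq).ne' hqt
    rw [haarNorm_of_ne_top hqt hg, haarNorm_of_ne_top hqt (by fun_prop)]
    simp_rw [ENNReal.mul_rpow_of_nonneg _ _ hq0.le]
    rw [lintegral_const_mul _ (by fun_prop), ENNReal.mul_rpow_of_nonneg _ _ (by positivity),
      ← ENNReal.rpow_mul, mul_one_div_cancel hq0.ne', ENNReal.rpow_one]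

theorem haarNorm_comp_mul {q : ℝ≥0∞} {g : ℝ → ℝ≥0∞} (hg : Measurable g) {c : ℝ} (hc : 0 < c) :
    haarNorm q (fun t => g (c * t)) = haarNorm q g := by
  by_cases hqt : q = ∞
  · subst hqt
    simp only [haarNorm_top]
    refine le_antisymm (iSup₂_le fun t ht => ?_) (iSup₂_le fun t ht => ?_)
    · exact le_iSup₂ (f := fun t (_ : t ∈ Set.Ioi (0 : ℝ)) => g t) (c * t) (mul_pos hc ht)
    · have := le_iSup₂ (f := fun t (_ : t ∈ Set.Ioi (0 : ℝ)) => g (c * t)) (c⁻¹ * t)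
        (mul_pos (inv_pos.2 hc) ht)
      rwa [mul_inv_cancel_left₀ hc.ne'] at this
  · rw [haarNorm_of_ne_top hqt hg, haarNorm_of_ne_top hqt (by fun_prop),
      lintegral_halfLineHaar_comp_mul (g := fun t => g t ^ q.toReal) (by fun_prop) hc]

theorem haarNorm_add_le {q : ℝ≥0∞} (hq : 1 ≤ q) {g h : ℝ → ℝ≥0∞} (hg : Measurable g)
    (hh : Measurable h) :
    haarNorm q (fun t => g t + h t) ≤ haarNorm q g + haarNorm q h := by
  by_cases hqt : q = ∞
  · subst hqt
    simp only [haarNorm_top]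
    exact iSup₂_le fun t ht => add_le_add
      (le_iSup₂ (f := fun t (_ : t ∈ Set.Ioi (0 : ℝ)) => g t) t ht)
      (le_iSup₂ (f := fun t (_ : t ∈ Set.Ioi (0 : ℝ)) => h t) t ht)
  · have hq1 : 1 ≤ q.toReal := by
      rw [← ENNReal.toReal_one]; exact ENNReal.toReal_mono hqt hq
    rw [haarNorm_of_ne_top hqt hg, haarNorm_of_ne_top hqt hh, haarNorm_of_ne_top hqt (by fun_prop)]
    exact ENNReal.lintegral_Lp_add_le hg.aemeasurable hh.aemeasurable hq1

theorem haarNorm_zero {q : ℝ≥0∞} (hq : 1 ≤ q) : haarNorm q (fun _ => 0) = 0 := by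
  have := haarNorm_const_mul hq (g := fun _ => 0) measurable_const 0
  simpa using this

theorem haarNorm_sum_le {q : ℝ≥0∞} (hq : 1 ≤ q) {g : ℕ → ℝ → ℝ≥0∞} (hg : ∀ j, Measurable (g j))
    (k : ℕ) :
    haarNorm q (fun t => ∑ j ∈ Finset.range k, g j t)
      ≤ ∑ j ∈ Finset.range k, haarNorm q (g j) := by
  induction k with
  | zero => simp [haarNorm_zero hq]
  | succ k ih =>
    simp only [Finset.sum_range_succ]
    refine (haarNorm_add_le hq (by fun_prop) (hg k)).trans ?_
    gcongr

/-- Monotone convergence; it carries Minkowski's inequality from finite sums to series. -/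
theorem haarNorm_iSup {q : ℝ≥0∞} (hq : 1 ≤ q) {g : ℕ → ℝ → ℝ≥0∞} (hg : ∀ j, Measurable (g j))
    (hmono : Monotone g) :
    haarNorm q (fun t => ⨆ k, g k t) = ⨆ k, haarNorm q (g k) := by
  by_cases hqt : q = ∞
  · subst hqt
    simp only [haarNorm_top]
    rw [iSup_comm]
    exact iSup_congr fun t => iSup_comm
  · have hq0 : 0 < q.toReal := ENNReal.toReal_pos (one_pos.trans_le hq).ne' hqt
    have h1 : ∀ r : ℝ, 0 < r → ∀ u : ℕ → ℝ≥0∞, (⨆ k, u k) ^ r = ⨆ k, u k ^ r := fun r hr u =>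
      (ENNReal.orderIsoRpow r hr).map_iSup u
    rw [haarNorm_of_ne_top hqt (.iSup hg)]
    simp_rw [haarNorm_of_ne_top hqt (hg _), h1 _ hq0]
    rw [lintegral_iSup (fun k => (hg k).pow_const _)
      fun i j hij t => ENNReal.rpow_le_rpow (hmono hij t) hq0.le, h1 _ (by positivity)]

theorem haarNorm_tsum_le {q : ℝ≥0∞} (hq : 1 ≤ q) {g : ℕ → ℝ → ℝ≥0∞} (hg : ∀ j, Measurable (g j)) :
    haarNorm q (fun t => ∑' j, g j t) ≤ ∑' j, haarNorm q (g j) := by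
  simp_rw [ENNReal.tsum_eq_iSup_nat]
  rw [haarNorm_iSup hq (fun k => by fun_prop)]
  · exact iSup_mono fun k => haarNorm_sum_le hq hg k
  · intro i j hij t
    exact Finset.sum_le_sum_of_subset (Finset.range_mono hij)

/-- Absorption for dilations: a bounded function which is controlled by a contracted dilate of
itself plus an error is controlled in norm by the error. -/
theorem haarNorm_le_of_le_dilate_add {q : ℝ≥0∞} (hq : 1 ≤ q) {h k : ℝ → ℝ≥0∞} (hk : Measurable k)
    {a M : ℝ≥0∞} (ha : a < 1) (hM : M ≠ ∞) {c : ℝ} (hc : 0 < c) (hb : ∀ t, 0 < t → h t ≤ M)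
    (hh : ∀ t, 0 < t → h t ≤ a * h (c * t) + k t) :
    haarNorm q h ≤ (1 - a)⁻¹ * haarNorm q k := by
  have hiter : ∀ (j : ℕ) (t : ℝ), 0 < t →
      h t ≤ a ^ j * h (c ^ j * t) + ∑ i ∈ Finset.range j, a ^ i * k (c ^ i * t) := by
    intro j
    induction j with
    | zero => intro t _; simp
    | succ j ih =>
      intro t ht
      refine (ih t ht).trans ?_
      rw [Finset.sum_range_succ, add_comm (Finset.sum _ _), ← add_assoc]
      gcongr
      refine (mul_le_mul_right (hh (c ^ j * t) (by positivity)) _).trans (le_of_eq ?_)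
      rw [mul_add, ← mul_assoc, ← mul_assoc, pow_succ, pow_succ, mul_comm c]
  have hle : ∀ t, 0 < t → h t ≤ ∑' i, a ^ i * k (c ^ i * t) := by
    intro t ht
    -- The a priori bound `M` serves only to kill the remainder after `j` iterations; it does not
    -- enter the constant.
    have hlim : Filter.Tendsto (fun j : ℕ => a ^ j * M + ∑' i, a ^ i * k (c ^ i * t)) Filter.atTop
        (nhds (0 * M + ∑' i, a ^ i * k (c ^ i * t))) :=
      (ENNReal.Tendsto.mul_const (ENNReal.tendsto_pow_atTop_nhds_zero_of_lt_one ha)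
        (Or.inr hM)).add tendsto_const_nhds
    rw [zero_mul, zero_add] at hlim
    refine ge_of_tendsto' hlim fun j => (hiter j t ht).trans ?_
    gcongr
    · exact hb _ (by positivity)
    · exact ENNReal.sum_le_tsum _
  refine (haarNorm_mono hle).trans ((haarNorm_tsum_le hq fun i => by fun_prop).trans ?_)
  rw [← ENNReal.tsum_geometric, ← ENNReal.tsum_mul_right]
  refine ENNReal.tsum_le_tsum fun i => le_of_eq ?_
  rw [haarNorm_const_mul hq (by fun_prop), haarNorm_comp_mul hk (by positivity)]

/-! ### Decreasing rearrangements and their averages. -/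

section Rearrangement

variable {α E : Type*} [MeasurableSpace α] [NormedAddCommGroup E] {μ : Measure α} {f : α → E}

theorem rearrangement_antitone : Antitone (rearrangement μ f) := fun _ _ hst =>
  sInf_le_sInf fun _ hx => le_trans hx (ENNReal.ofReal_le_ofReal hst)

theorem measurable_rearrangement : Measurable (rearrangement μ f) :=
  rearrangement_antitone.measurable

/-- The infimum defining `f*(t)` is attained: superlevel sets increase as the level decreases to it,
and continuity from below needs no finiteness of measure. -/
theorem measure_rearrangement_lt_le (t : ℝ) :
    μ {x | rearrangement μ f t < ‖f x‖ₑ} ≤ ENNReal.ofReal t := by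
  have hne : {s : ℝ≥0∞ | μ {x | s < ‖f x‖ₑ} ≤ ENNReal.ofReal t}.Nonempty := ⟨∞, by simp⟩
  obtain ⟨u, hu, hlim, hmem⟩ := exists_seq_tendsto_sInf hne (OrderBot.bddBelow _)
  have hset : {x | rearrangement μ f t < ‖f x‖ₑ} = ⋃ k, {x | u k < ‖f x‖ₑ} := by
    ext x
    simp only [Set.mem_ofPred_eq, Set.mem_iUnion]
    refine ⟨fun hx => ?_, fun ⟨k, hk⟩ => lt_of_le_of_lt (sInf_le (hmem k)) hk⟩
    exact ((hlim.eventually (gt_mem_nhds hx))).exists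
  have hdir : Monotone fun k => {x | u k < ‖f x‖ₑ} := fun i j hij x hx =>
    lt_of_le_of_lt (hu hij) hx
  rw [hset, hdir.measure_iUnion]
  exact iSup_le hmem

theorem lt_rearrangement_iff {s : ℝ≥0∞} {t : ℝ} :
    s < rearrangement μ f t ↔ ENNReal.ofReal t < μ {x | s < ‖f x‖ₑ} := by
  rw [← not_le, ← not_le, not_iff_not]
  exact ⟨fun h => (measure_mono fun x hx => lt_of_le_of_lt h hx).trans
    (measure_rearrangement_lt_le t), fun h => sInf_le h⟩

theorem rearrangement_le_of_bound {M : ℝ≥0∞} (hM : ∀ x, ‖f x‖ₑ ≤ M) (t : ℝ) :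
    rearrangement μ f t ≤ M := by
  refine sInf_le ?_
  have : {x | M < ‖f x‖ₑ} = ∅ := Set.eq_empty_of_forall_notMem fun x hx => (hM x).not_gt hx
  simp [this]

theorem rearrangement_eq_zero {t : ℝ} (ht : μ (Function.support f) ≤ ENNReal.ofReal t) :
    rearrangement μ f t = 0 := by
  refine le_antisymm (sInf_le ?_) bot_le
  have : {x | (0 : ℝ≥0∞) < ‖f x‖ₑ} = Function.support f := by
    ext x; simp [pos_iff_ne_zero]
  rwa [Set.mem_ofPred_eq, this]

/-- The Hardy–Littlewood inequality for the indicator function of a set. -/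
theorem setLIntegral_enorm_le_lintegral_rearrangement {f : α → ℝ} (hf : Measurable f) {A : Set α}
    {M : ℝ≥0∞} (hM : M ≠ ∞) (hfM : ∀ x, ‖f x‖ₑ ≤ M) {t : ℝ}
    (hAt : μ A ≤ ENNReal.ofReal t) :
    ∫⁻ x in A, ‖f x‖ₑ ∂μ ≤ ∫⁻ s in Set.Ioo 0 t, rearrangement μ f s := by
  have hfin : ∀ s, rearrangement μ f s ≠ ∞ := fun s =>
    ne_top_of_le_ne_top hM (rearrangement_le_of_bound hfM s)
  have h1 : ∫⁻ x in A, ‖f x‖ₑ ∂μ = ∫⁻ l in Set.Ioi 0, (μ.restrict A) {x | l < ‖f x‖} := by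
    rw [← lintegral_eq_lintegral_meas_lt _ (Filter.Eventually.of_forall fun x => norm_nonneg _)
      hf.norm.aemeasurable]
    simp only [ofReal_norm]
  have h2 : ∫⁻ s in Set.Ioo 0 t, rearrangement μ f s = ∫⁻ l in Set.Ioi 0,
      (volume.restrict (Set.Ioo 0 t)) {s | l < (rearrangement μ f s).toReal} := by
    rw [← lintegral_eq_lintegral_meas_lt _ (Filter.Eventually.of_forall fun x =>
      ENNReal.toReal_nonneg) measurable_rearrangement.ennreal_toReal.aemeasurable]
    simp [ENNReal.ofReal_toReal (hfin _)]
  rw [h1, h2]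
  refine setLIntegral_mono' measurableSet_Ioi fun l hl => ?_
  have hl0 : (0 : ℝ) ≤ l := le_of_lt hl
  rw [Measure.restrict_apply (measurableSet_lt measurable_const hf.norm),
    Measure.restrict_apply (measurableSet_lt measurable_const
      measurable_rearrangement.ennreal_toReal)]
  have hset : {x | l < ‖f x‖} = {x | ENNReal.ofReal l < ‖f x‖ₑ} := by
    ext x
    simp only [Set.mem_ofPred_eq]
    rw [← ofReal_norm, ENNReal.ofReal_lt_ofReal_iff_of_nonneg hl0]
  set m := μ {x | ENNReal.ofReal l < ‖f x‖ₑ} with hm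
  -- Layer by layer, `|A ∩ {|f| > l}| ≤ min(t, m)`, and `f*` exceeds `l` on an initial interval of
  -- that length inside `(0, t)`.
  have hsub : Set.Ioo 0 (min (ENNReal.ofReal t) m).toReal ⊆
      {s | l < (rearrangement μ f s).toReal} ∩ Set.Ioo 0 t := by
    rintro s ⟨hs0, hs⟩
    have hs' : ENNReal.ofReal s < min (ENNReal.ofReal t) m :=
      (ENNReal.ofReal_lt_iff_lt_toReal hs0.le
        (ne_top_of_le_ne_top ENNReal.ofReal_ne_top (min_le_left _ _))).2 hs
    obtain ⟨hst, hsm⟩ := lt_min_iff.1 hs'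
    refine ⟨?_, hs0, (ENNReal.ofReal_lt_ofReal_iff_of_nonneg hs0.le).1 hst⟩
    exact (ENNReal.ofReal_lt_iff_lt_toReal hl0 (hfin s)).1 (lt_rearrangement_iff.2 hsm)
  refine le_trans ?_ (measure_mono hsub)
  rw [Real.volume_Ioo, sub_zero, ENNReal.ofReal_toReal
    (ne_top_of_le_ne_top ENNReal.ofReal_ne_top (min_le_left _ _)), hset]
  exact le_min ((measure_mono Set.inter_subset_right).trans hAt) (measure_mono Set.inter_subset_left)

theorem lintegral_rearrangement_le {M : ℝ≥0∞} (hM : ∀ x, ‖f x‖ₑ ≤ M) (a b : ℝ) :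
    ∫⁻ s in Set.Ioo a b, rearrangement μ f s ≤ M * ENNReal.ofReal (b - a) := by
  refine (lintegral_mono fun s => rearrangement_le_of_bound hM s).trans ?_
  simp

theorem maximalRearrangement_le_of_bound {M : ℝ≥0∞} (hM : ∀ x, ‖f x‖ₑ ≤ M) (t : ℝ) :
    maximalRearrangement μ f t ≤ M := by
  refine ENNReal.div_le_of_le_mul ?_
  simpa using lintegral_rearrangement_le (μ := μ) hM 0 t

theorem maximalRearrangement_mul {t : ℝ} (ht : 0 < t) :
    maximalRearrangement μ f t * ENNReal.ofReal t = ∫⁻ s in Set.Ioo 0 t, rearrangement μ f s :=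
  ENNReal.div_mul_cancel (by simpa using ht) ENNReal.ofReal_ne_top

theorem rearrangement_le_maximalRearrangement {t : ℝ} (ht : 0 < t) :
    rearrangement μ f t ≤ maximalRearrangement μ f t := by
  rw [maximalRearrangement, ENNReal.le_div_iff_mul_le (Or.inl (by simpa using ht))
    (Or.inl ENNReal.ofReal_ne_top)]
  calc _ = ∫⁻ _ in Set.Ioo 0 t, rearrangement μ f t := by simp
    _ ≤ _ := setLIntegral_mono' measurableSet_Ioo fun s hs => rearrangement_antitone hs.2.le

theorem measurable_maximalRearrangement : Measurable (maximalRearrangement μ f) := by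
  have : Monotone fun t : ℝ => ∫⁻ s in Set.Ioo 0 t, rearrangement μ f s := fun a b hab =>
    lintegral_mono_set (Set.Ioo_subset_Ioo_right hab)
  exact this.measurable.div (by fun_prop)

/-- Split the average at `t/2` and use monotonicity of `f*` on the right half. The factor `1/2`
drives the absorption for both Hardy's inequality and `f** - f*`. -/
theorem maximalRearrangement_le_half {t : ℝ} (ht : 0 < t) :
    maximalRearrangement μ f t ≤
      2⁻¹ * maximalRearrangement μ f (t / 2) + 2⁻¹ * rearrangement μ f (t / 2) := by
  have ht2 : 0 < t / 2 := half_pos ht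
  have h2 : ENNReal.ofReal t = 2 * ENNReal.ofReal (t / 2) := by
    rw [← ENNReal.ofReal_ofNat, ← ENNReal.ofReal_mul (by norm_num)]; congr 1; ring
  have h3 : (2⁻¹ * maximalRearrangement μ f (t / 2) + 2⁻¹ * rearrangement μ f (t / 2)) *
      ENNReal.ofReal t = maximalRearrangement μ f (t / 2) * ENNReal.ofReal (t / 2) +
        rearrangement μ f (t / 2) * ENNReal.ofReal (t / 2) := by
    rw [← mul_add, h2, mul_mul_mul_comm, ENNReal.inv_mul_cancel (by simp) (by simp), one_mul,
      add_mul]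
  rw [maximalRearrangement, ENNReal.div_le_iff (by simpa using ht) ENNReal.ofReal_ne_top, h3,
    maximalRearrangement_mul ht2]
  calc _ ≤ ∫⁻ s in Set.Ioo 0 (t / 2) ∪ Set.Ico (t / 2) t, rearrangement μ f s :=
        lintegral_mono_set fun s hs => by
          rcases lt_or_ge s (t / 2) with h | h
          · exact Or.inl ⟨hs.1, h⟩
          · exact Or.inr ⟨h, hs.2⟩
    _ ≤ _ := lintegral_union_le _ _ _
    _ ≤ _ := by
        gcongr
        calc _ ≤ ∫⁻ _ in Set.Ico (t / 2) t, rearrangement μ f (t / 2) :=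
              setLIntegral_mono' measurableSet_Ico fun s hs => rearrangement_antitone hs.1
          _ = _ := by
              rw [lintegral_const, Measure.restrict_apply_univ, Real.volume_Ico, sub_half]

theorem maximalRearrangement_le_lintegral_div {t : ℝ} :
    maximalRearrangement μ f t ≤ (∫⁻ s in Set.Ioi 0, rearrangement μ f s) / ENNReal.ofReal t :=
  ENNReal.div_le_div_right (lintegral_mono_set Set.Ioo_subset_Ioi_self) _

/-- `f*` is bounded by `M` and vanishes beyond the measure of the support. -/
theorem lintegral_rearrangement_lt_top {M : ℝ≥0∞} (hM : M ≠ ∞) (hfM : ∀ x, ‖f x‖ₑ ≤ M)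
    (hs : μ (Function.support f) ≠ ∞) : ∫⁻ s in Set.Ioi 0, rearrangement μ f s < ∞ := by
  set T := (μ (Function.support f)).toReal
  have h0 : ∀ s, T ≤ s → rearrangement μ f s = 0 := fun s hTs => by
    refine rearrangement_eq_zero ?_
    rw [← ENNReal.ofReal_toReal hs]
    exact ENNReal.ofReal_le_ofReal hTs
  calc _ ≤ ∫⁻ s in Set.Ioi 0, (Set.Iio T).indicator (fun _ => M) s := by
        refine lintegral_mono fun s => ?_
        by_cases hsT : s < T
        · rw [Set.indicator_of_mem (by exact hsT)]; exact rearrangement_le_of_bound hfM s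
        · rw [h0 s (not_lt.1 hsT)]; exact bot_le
    _ < ∞ := by
        rw [lintegral_indicator measurableSet_Iio, lintegral_const,
          Measure.restrict_restrict measurableSet_Iio, Set.inter_comm, Set.Ioi_inter_Iio]
        simpa using ENNReal.mul_lt_top hM.lt_top ENNReal.ofReal_lt_top

end Rearrangement

/-! ### Smooth truncation between two levels. -/

theorem Real.deriv_smoothTransition_of_nonpos {s : ℝ} (hs : s ≤ 0) :
    deriv Real.smoothTransition s = 0 :=
  IsLocalMin.deriv_eq_zero <| Filter.Eventually.of_forall fun y => by
    rw [Real.smoothTransition.zero_of_nonpos hs]; exact Real.smoothTransition.nonneg y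

theorem Real.deriv_smoothTransition_of_one_le {s : ℝ} (hs : 1 ≤ s) :
    deriv Real.smoothTransition s = 0 :=
  IsLocalMax.deriv_eq_zero <| Filter.Eventually.of_forall fun y => by
    rw [Real.smoothTransition.one_of_one_le hs]; exact Real.smoothTransition.le_one y

theorem Real.exists_norm_deriv_smoothTransition_le :
    ∃ C : ℝ≥0, ∀ s, ‖deriv Real.smoothTransition s‖ ≤ C := by
  have hcont : Continuous (deriv Real.smoothTransition) :=
    (Real.smoothTransition.contDiff (n := 1)).continuous_deriv le_rfl
  obtain ⟨C, hC⟩ := isCompact_Icc.exists_bound_of_continuousOn (s := Set.Icc (0 : ℝ) 1)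
    hcont.continuousOn
  refine ⟨C.toNNReal, fun s => ?_⟩
  by_cases hs : s ∈ Set.Icc (0 : ℝ) 1
  · exact (hC s hs).trans (Real.le_coe_toNNReal C)
  · rw [Set.mem_Icc, not_and_or, not_le, not_le] at hs
    rcases hs with hs | hs
    · simp [Real.deriv_smoothTransition_of_nonpos hs.le]
    · simp [Real.deriv_smoothTransition_of_one_le hs.le]

/-- Smooth truncation of `f` between the levels `a` and `b`: it vanishes where `|f| ≤ a` and
equals one where `|f| ≥ b`. -/
noncomputable def levelTruncation {E : Type*} (a b : ℝ) (f : E → ℝ) (x : E) : ℝ :=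
  Real.smoothTransition ((f x ^ 2 - a ^ 2) / (b ^ 2 - a ^ 2))

section LevelTruncation

variable {E : Type*} {a b : ℝ} {f : E → ℝ}

theorem contDiff_levelTruncation [NormedAddCommGroup E] [NormedSpace ℝ E]
    (hf : ContDiff ℝ 1 f) :
    ContDiff ℝ 1 (levelTruncation a b f) :=
  -- Using `f ^ 2` instead of `|f|` avoids the corner at zeros of `f`.
  (Real.smoothTransition.contDiff (n := 1)).comp (((hf.pow 2).sub contDiff_const).div_const _)

theorem hasCompactSupport_levelTruncation [TopologicalSpace E] (ha : 0 ≤ a)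
    (hab : a < b) (hf : HasCompactSupport f) :
    HasCompactSupport (levelTruncation a b f) := by
  refine hf.comp_left (g := fun s => Real.smoothTransition ((s ^ 2 - a ^ 2) / (b ^ 2 - a ^ 2))) ?_
  refine Real.smoothTransition.zero_of_nonpos (div_nonpos_of_nonpos_of_nonneg ?_ ?_) <;> nlinarith

theorem levelTruncation_eq_one (ha : 0 ≤ a) (hab : a < b) {x : E} (hx : b ≤ |f x|) :
    levelTruncation a b f x = 1 := by
  refine Real.smoothTransition.one_of_one_le ((one_le_div (by nlinarith)).2 ?_)
  rw [← sq_abs (f x)]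
  nlinarith

/-- The chain rule gives the factor `2|f|/(b² - a²)`, at most `2/(b - a)` because `|f| ≤ a + b` in
the layer; outside it the transition has zero derivative, endpoints included. -/
theorem enorm_fderiv_levelTruncation_le [NormedAddCommGroup E] [NormedSpace ℝ E] {C : ℝ≥0}
    (hC : ∀ s, ‖deriv Real.smoothTransition s‖ ≤ C) (ha : 0 ≤ a) (hab : a < b)
    (hf : ContDiff ℝ 1 f) (x : E) :
    ‖fderiv ℝ (levelTruncation a b f) x‖ₑ ≤
      {x | a < |f x| ∧ |f x| < b}.indicator
        (fun x => ENNReal.ofReal (2 * C / (b - a)) * ‖fderiv ℝ f x‖ₑ) x := by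
  have hD : 0 < b ^ 2 - a ^ 2 := by nlinarith
  have hfx : HasFDerivAt f (fderiv ℝ f x) x := (hf.differentiable one_ne_zero x).hasFDerivAt
  set s := (f x ^ 2 - a ^ 2) / (b ^ 2 - a ^ 2) with hs
  have h1 : HasFDerivAt (fun x => (f x ^ 2 - a ^ 2) / (b ^ 2 - a ^ 2))
      ((2 * f x / (b ^ 2 - a ^ 2)) • fderiv ℝ f x) x := by
    have h2 : HasDerivAt (fun y : ℝ => (y ^ 2 - a ^ 2) / (b ^ 2 - a ^ 2))
        (2 * f x / (b ^ 2 - a ^ 2)) (f x) := by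
      simpa using (((hasDerivAt_id (f x)).pow 2).sub_const (a ^ 2)).div_const (b ^ 2 - a ^ 2)
    exact h2.comp_hasFDerivAt x hfx
  have h3 : HasDerivAt Real.smoothTransition (deriv Real.smoothTransition s) s :=
    ((Real.smoothTransition.contDiff (n := 1)).differentiable one_ne_zero s).hasDerivAt
  have h4 : fderiv ℝ (levelTruncation a b f) x =
      deriv Real.smoothTransition s • (2 * f x / (b ^ 2 - a ^ 2)) • fderiv ℝ f x :=
    (h3.comp_hasFDerivAt x h1).fderiv
  rw [h4]
  by_cases hx : x ∈ {x | a < |f x| ∧ |f x| < b}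
  · rw [Set.indicator_of_mem hx, smul_smul, enorm_smul]
    gcongr
    rw [← ofReal_norm]
    refine ENNReal.ofReal_le_ofReal ?_
    rw [norm_mul, norm_div, norm_mul, Real.norm_of_nonneg hD.le, Real.norm_ofNat, Real.norm_eq_abs (f x)]
    have h5 : 2 * |f x| / (b ^ 2 - a ^ 2) ≤ 2 / (b - a) := by
      rw [div_le_div_iff₀ hD (by linarith)]
      have : |f x| ≤ b + a := by linarith [hx.2]
      nlinarith
    calc _ ≤ (C : ℝ) * (2 / (b - a)) := by gcongr; exact hC s
      _ = _ := by ring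
  · have h6 : deriv Real.smoothTransition s = 0 := by
      rw [Set.mem_ofPred_eq, not_and_or, not_lt, not_lt] at hx
      rcases hx with hx | hx
      · refine Real.deriv_smoothTransition_of_nonpos (div_nonpos_of_nonpos_of_nonneg ?_ hD.le)
        rw [← sq_abs (f x)]
        nlinarith [abs_nonneg (f x)]
      · refine Real.deriv_smoothTransition_of_one_le ((one_le_div hD).2 ?_)
        rw [← sq_abs (f x)]
        nlinarith
    rw [h6, zero_smul]
    exact (enorm_zero (E := E →L[ℝ] ℝ)).le.trans bot_le

end LevelTruncation

/-! ### Sobolev estimates on the layers of `f`. -/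

/-- Weak-type Sobolev inequality between two levels of the function. -/
theorem exists_const_measure_lt_le_lintegral_fderiv {n : ℕ} (hn : 1 < n) :
    ∃ C : ℝ≥0, ∀ f : EuclideanSpace ℝ (Fin n) → ℝ, ContDiff ℝ 1 f → HasCompactSupport f →
      ∀ a b : ℝ, 0 ≤ a → a < b →
        ENNReal.ofReal (b - a) * volume {x | b < |f x|} ^ (1 - 1 / (n : ℝ)) ≤
          C * ∫⁻ x in {x | a < |f x| ∧ |f x| < b}, ‖fderiv ℝ f x‖ₑ := by
  obtain ⟨K, hK⟩ := Real.exists_norm_deriv_smoothTransition_le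
  have hn0 : (0 : ℝ) < n := by positivity
  have hn1 : (1 : ℝ) < n := by exact_mod_cast hn
  have hr : 0 < 1 - 1 / (n : ℝ) := by rw [sub_pos, div_lt_one hn0]; exact hn1
  set p : ℝ≥0 := (n : ℝ≥0).conjExponent with hp_def
  have hp : NNReal.HolderConjugate (n : ℝ≥0) p := .conjExponent (by exact_mod_cast hn)
  have hpr : (p : ℝ)⁻¹ = 1 - 1 / (n : ℝ) := by
    have := hp.coe.inv_add_inv_eq_one
    simp only [NNReal.coe_natCast] at this
    rw [one_div]; linarith
  have hp' : NNReal.HolderConjugate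
      (Module.finrank ℝ (EuclideanSpace ℝ (Fin n)) : ℝ≥0) p := by simpa using hp
  set G := eLpNormLESNormFDerivOneConst (volume : Measure (EuclideanSpace ℝ (Fin n))) p
  refine ⟨G * (2 * K), fun f hf hfc a b ha hab => ?_⟩
  have hba : 0 < b - a := sub_pos.2 hab
  have hu := contDiff_levelTruncation (a := a) (b := b) hf
  have hgns := eLpNorm_le_eLpNorm_fderiv_one (volume : Measure (EuclideanSpace ℝ (Fin n))) hu
    (hasCompactSupport_levelTruncation ha hab hfc) hp'
  -- Chebyshev at height 1, the value of the truncation wherever `|f| ≥ b`.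
  have hcheb := mul_meas_ge_le_pow_eLpNorm (p := p) (volume : Measure (EuclideanSpace ℝ (Fin n)))
    (by exact_mod_cast hp.symm.pos.ne') ENNReal.coe_ne_top hu.continuous.aestronglyMeasurable 1
  have hp0 : (0 : ℝ) < p := hp.coe.symm.pos
  have h1 : volume {x | b < |f x|} ^ (1 - 1 / (n : ℝ)) ≤
      eLpNorm (levelTruncation a b f) p volume := by
    rw [← hpr, ENNReal.rpow_inv_le_iff hp0]
    refine le_trans (measure_mono fun x hx => ?_) ((one_mul _).symm.le.trans hcheb)
    rw [Set.mem_ofPred_eq, levelTruncation_eq_one ha hab (le_of_lt hx)]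
    simp
  have hmeas : MeasurableSet {x | a < |f x| ∧ |f x| < b} :=
    (measurableSet_lt measurable_const hf.continuous.abs.measurable).inter
      (measurableSet_lt hf.continuous.abs.measurable measurable_const)
  have h2 : eLpNorm (fderiv ℝ (levelTruncation a b f)) 1 volume ≤
      ENNReal.ofReal (2 * K / (b - a)) * ∫⁻ x in {x | a < |f x| ∧ |f x| < b}, ‖fderiv ℝ f x‖ₑ := by
    rw [eLpNorm_one_eq_lintegral_enorm]
    refine (lintegral_mono fun x => enorm_fderiv_levelTruncation_le hK ha hab hf x).trans ?_
    rw [lintegral_indicator hmeas, lintegral_const_mul' _ _ ENNReal.ofReal_ne_top]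
  calc _ ≤ ENNReal.ofReal (b - a) * (G * (ENNReal.ofReal (2 * K / (b - a)) *
        ∫⁻ x in {x | a < |f x| ∧ |f x| < b}, ‖fderiv ℝ f x‖ₑ)) := by
        gcongr
        exact h1.trans (hgns.trans (by gcongr))
    _ = G * (ENNReal.ofReal (b - a) * ENNReal.ofReal (2 * K / (b - a))) *
        ∫⁻ x in {x | a < |f x| ∧ |f x| < b}, ‖fderiv ℝ f x‖ₑ := by ring
    _ = _ := by
        rw [← ENNReal.ofReal_mul hba.le, mul_div_cancel₀ _ hba.ne']
        congr 2
        rw [ENNReal.ofReal, Real.toNNReal_mul (by norm_num)]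
        simp

/-- Sobolev inequality for the increments of the decreasing rearrangement. -/
theorem exists_const_rearrangement_sub_le {n : ℕ} (hn : 1 < n) :
    ∃ C : ℝ≥0, ∀ f : EuclideanSpace ℝ (Fin n) → ℝ, ContDiff ℝ 1 f → HasCompactSupport f →
      ∀ s t : ℝ, 0 < s →
        (rearrangement volume f s - rearrangement volume f t) *
            ENNReal.ofReal s ^ (1 - 1 / (n : ℝ)) ≤
          C * ∫⁻ x in {x | rearrangement volume f t < ‖f x‖ₑ ∧ ‖f x‖ₑ < rearrangement volume f s},
            ‖fderiv ℝ f x‖ₑ := by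
  obtain ⟨C, hC⟩ := exists_const_measure_lt_le_lintegral_fderiv hn
  refine ⟨C, fun f hf hfc s t hs => ?_⟩
  have hn0 : (0 : ℝ) < n := by positivity
  have hr : 0 ≤ 1 - 1 / (n : ℝ) := by
    rw [sub_nonneg, div_le_one hn0]; exact_mod_cast hn.le
  rcases le_or_gt (rearrangement volume f s) (rearrangement volume f t) with hle | hlt
  · simp [tsub_eq_zero_of_le hle]
  set A := rearrangement volume f t
  set B := rearrangement volume f s
  set R := C * ∫⁻ x in {x | A < ‖f x‖ₑ ∧ ‖f x‖ₑ < B}, ‖fderiv ℝ f x‖ₑ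
  have hA : A ≠ ∞ := hlt.ne_top
  -- The level `B` itself is unsuitable, since `{|f| > B}` has measure at most `s`; every `l < B`
  -- has `|{|f| > l}| > s`. Afterwards `l` tends to `B`.
  have key : ∀ l, A < l → l < B → (l - A) * ENNReal.ofReal s ^ (1 - 1 / (n : ℝ)) ≤ R := by
    intro l hAl hlB
    have hl : l ≠ ∞ := hlB.ne_top
    have habs : ∀ x, ‖f x‖ₑ = ENNReal.ofReal |f x| := fun x => Real.enorm_eq_ofReal_abs _
    have h1 := hC f hf hfc A.toReal l.toReal ENNReal.toReal_nonneg
      ((ENNReal.toReal_lt_toReal hA hl).2 hAl)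
    have e1 : {x | l.toReal < |f x|} = {x | l < ‖f x‖ₑ} := by
      ext x
      rw [Set.mem_ofPred_eq, Set.mem_ofPred_eq, habs, ENNReal.lt_ofReal_iff_toReal_lt hl]
    rw [ENNReal.ofReal_sub _ ENNReal.toReal_nonneg, ENNReal.ofReal_toReal hl,
      ENNReal.ofReal_toReal hA, e1] at h1
    calc _ ≤ (l - A) * volume {x | l < ‖f x‖ₑ} ^ (1 - 1 / (n : ℝ)) := by
          gcongr
          exact (lt_rearrangement_iff.1 hlB).le
      _ ≤ _ := h1
      _ ≤ R := by
          have hsub : {x | A.toReal < |f x| ∧ |f x| < l.toReal} ⊆ {x | A < ‖f x‖ₑ ∧ ‖f x‖ₑ < B} := by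
            intro x hx
            refine ⟨?_, lt_trans ?_ hlB⟩
            · rw [habs, ENNReal.lt_ofReal_iff_toReal_lt hA]; exact hx.1
            · rw [habs, ENNReal.ofReal_lt_iff_lt_toReal (abs_nonneg _) hl]; exact hx.2
          exact mul_le_mul_right (lintegral_mono_set hsub) _
  have hs0 : ENNReal.ofReal s ^ (1 - 1 / (n : ℝ)) ≠ 0 :=
    (ENNReal.rpow_pos (by simpa using hs) ENNReal.ofReal_ne_top).ne'
  have hst : ENNReal.ofReal s ^ (1 - 1 / (n : ℝ)) ≠ ∞ :=
    ENNReal.rpow_ne_top_of_nonneg hr ENNReal.ofReal_ne_top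
  rw [← ENNReal.le_div_iff_mul_le (Or.inl hs0) (Or.inl hst), tsub_le_iff_right]
  refine le_of_forall_lt_imp_le_of_dense fun l hlB => ?_
  rcases le_or_gt l A with hlA | hAl
  · exact hlA.trans le_add_self
  · rw [← tsub_le_iff_right, ENNReal.le_div_iff_mul_le (Or.inl hs0) (Or.inl hst)]
    exact key l hAl hlB

theorem ENNReal.ofReal_mul_rpow {c t : ℝ} (hc : 0 ≤ c) {a : ℝ} (ha : 0 ≤ a) :
    ENNReal.ofReal (c * t) ^ a = ENNReal.ofReal c ^ a * ENNReal.ofReal t ^ a := by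
  rw [ENNReal.ofReal_mul hc, ENNReal.mul_rpow_of_nonneg _ _ ha]

/-! ### Hardy-type inequalities by absorption. -/

section Hardy

variable {α E : Type*} [MeasurableSpace α] [NormedAddCommGroup E] {μ : Measure α} {f : α → E}
  {q M : ℝ≥0∞}

/-- Hardy's inequality for the maximal average of the rearrangement. -/
theorem haarNorm_maximalRearrangement_le (hq : 1 ≤ q) (hM : M ≠ ∞) (hfM : ∀ x, ‖f x‖ₑ ≤ M)
    (hs : μ (Function.support f) ≠ ∞) {a : ℝ} (ha0 : 0 ≤ a) (ha1 : a < 1) :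
    haarNorm q (fun t => maximalRearrangement μ f t * ENNReal.ofReal t ^ a) ≤
      (1 - 2 ^ a * 2⁻¹)⁻¹ *
        ((2 ^ a * 2⁻¹) * haarNorm q (fun t => rearrangement μ f t * ENNReal.ofReal t ^ a)) := by
  have hF : Measurable (rearrangement μ f) := measurable_rearrangement
  set I := ∫⁻ s in Set.Ioi 0, rearrangement μ f s
  have hI : I ≠ ∞ := (lintegral_rearrangement_lt_top hM hfM hs).ne
  have hc : (2 : ℝ≥0∞) ^ a * 2⁻¹ < 1 := by
    rw [← ENNReal.rpow_neg_one, ← ENNReal.rpow_add _ _ (by simp) (by simp)]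
    exact ENNReal.rpow_lt_one_of_one_lt_of_neg (by norm_num) (by linarith)
  have hk : Measurable fun t => rearrangement μ f t * ENNReal.ofReal t ^ a := by fun_prop
  have h2 : (0 : ℝ) < 1 / 2 := by norm_num
  rw [← haarNorm_comp_mul hk h2, ← haarNorm_const_mul hq (by fun_prop)]
  -- A priori bound: `f** t^a ≤ M` for `t ≤ 1`, while for `t > 1` one has `f** ≤ I/t` and `t^a ≤ t`.
  refine haarNorm_le_of_le_dilate_add hq (by fun_prop) hc
    (M := M + I) (ENNReal.add_ne_top.2 ⟨hM, hI⟩) h2 (fun t ht => ?_) fun t ht => ?_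
  · rcases le_or_gt t 1 with h1 | h1
    · refine le_trans ?_ le_self_add
      calc _ ≤ M * 1 := mul_le_mul' (maximalRearrangement_le_of_bound hfM t)
            (ENNReal.rpow_le_one (by simpa using h1) ha0)
        _ = M := mul_one M
    · refine le_trans ?_ le_add_self
      have h0 : ENNReal.ofReal t ≠ 0 := by simpa using ht
      calc _ ≤ I / ENNReal.ofReal t * ENNReal.ofReal t ^ (1 : ℝ) :=
            mul_le_mul' maximalRearrangement_le_lintegral_div
              (ENNReal.rpow_le_rpow_of_exponent_le (by simpa using h1.le) ha1.le)
        _ = I := by rw [ENNReal.rpow_one, ENNReal.div_mul_cancel h0 ENNReal.ofReal_ne_top]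
  · have e : t = 2 * (1 / 2 * t) := by ring
    have e2 : t / 2 = 1 / 2 * t := by ring
    have e3 : ENNReal.ofReal t ^ a = 2 ^ a * ENNReal.ofReal (1 / 2 * t) ^ a := by
      conv_lhs => rw [e, ENNReal.ofReal_mul_rpow zero_le_two ha0, ENNReal.ofReal_ofNat]
    refine (mul_le_mul_left (maximalRearrangement_le_half ht) _).trans (le_of_eq ?_)
    rw [e3, e2]
    ring

/-- Here the dilation expands: `f*(t)` is `f*(2t)` plus an increment, and the weight turns this into
a recursion with factor `2^{-b}`. It is less than 1 only for `b > 0`, so the case `b = 0` needs the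
oscillation instead. -/
theorem haarNorm_rearrangement_le (hq : 1 ≤ q) (hM : M ≠ ∞) (hfM : ∀ x, ‖f x‖ₑ ≤ M)
    (hs : μ (Function.support f) ≠ ∞) {b : ℝ} (hb : 0 < b) :
    haarNorm q (fun t => rearrangement μ f t * ENNReal.ofReal t ^ b) ≤
      (1 - (2 ^ b)⁻¹)⁻¹ * ((2 ^ b)⁻¹ * haarNorm q (fun t =>
        (rearrangement μ f (t / 2) - rearrangement μ f t) * ENNReal.ofReal t ^ b)) := by
  have hF : Measurable (rearrangement μ f) := measurable_rearrangement
  have hk : Measurable fun t =>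
      (rearrangement μ f (t / 2) - rearrangement μ f t) * ENNReal.ofReal t ^ b := by fun_prop
  have h1b : (1 : ℝ≥0∞) < 2 ^ b := ENNReal.one_lt_rpow (by norm_num) hb
  have hbt : (2 : ℝ≥0∞) ^ b ≠ ∞ := ENNReal.rpow_ne_top_of_nonneg hb.le (by simp)
  set T := (μ (Function.support f)).toReal
  rw [← haarNorm_comp_mul hk two_pos, ← haarNorm_const_mul hq (by fun_prop)]
  refine haarNorm_le_of_le_dilate_add hq (by fun_prop) (ENNReal.inv_lt_one.2 h1b)
    (M := M * ENNReal.ofReal T ^ b) (ENNReal.mul_ne_top hM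
      (ENNReal.rpow_ne_top_of_nonneg hb.le ENNReal.ofReal_ne_top)) two_pos
    (fun t ht => ?_) fun t ht => ?_
  · rcases le_or_gt T t with h1 | h1
    · rw [rearrangement_eq_zero, zero_mul]
      · exact bot_le
      · rw [← ENNReal.ofReal_toReal hs]
        exact ENNReal.ofReal_le_ofReal h1
    · gcongr
      exact rearrangement_le_of_bound hfM t
  · rw [ENNReal.ofReal_mul_rpow zero_le_two hb.le, ENNReal.ofReal_ofNat,
      mul_div_cancel_left₀ t two_ne_zero, ← mul_add, ← add_mul, add_comm,
      tsub_add_cancel_of_le (rearrangement_antitone (by linarith)),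
      mul_left_comm, ← mul_assoc, ← mul_assoc, mul_assoc _ (2 ^ b)⁻¹,
      ENNReal.inv_mul_cancel (zero_lt_one.trans h1b).ne' hbt, mul_one]

/-- Halving the average bounds the oscillation at `t` by half the oscillation at `t/2` plus `f*(t/2)
- f*(t)`; no power weight is needed for contraction. -/
theorem haarNorm_maximalRearrangement_sub_le (hq : 1 ≤ q) (hM : M ≠ ∞)
    (hfM : ∀ x, ‖f x‖ₑ ≤ M) :
    haarNorm q (fun t => maximalRearrangement μ f t - rearrangement μ f t) ≤
      2 * haarNorm q (fun t => rearrangement μ f (t / 2) - rearrangement μ f t) := by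
  have hF : Measurable (rearrangement μ f) := measurable_rearrangement
  have h2 : (2 : ℝ≥0∞) = (1 - 2⁻¹)⁻¹ := by rw [ENNReal.one_sub_inv_two, inv_inv]
  rw [h2]
  refine haarNorm_le_of_le_dilate_add hq (by fun_prop) (ENNReal.inv_lt_one.2 (by norm_num)) hM
    (c := 1 / 2) (by norm_num)
    (fun t _ => tsub_le_self.trans (maximalRearrangement_le_of_bound hfM t)) fun t ht => ?_
  have e2 : 1 / 2 * t = t / 2 := by ring
  rw [e2, tsub_le_iff_right]
  have ht2 : 0 < t / 2 := half_pos ht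
  calc _ ≤ _ := maximalRearrangement_le_half ht
    _ = 2⁻¹ * (maximalRearrangement μ f (t / 2) - rearrangement μ f (t / 2)) +
        (2⁻¹ * rearrangement μ f (t / 2) + 2⁻¹ * rearrangement μ f (t / 2)) := by
      conv_lhs => rw [← tsub_add_cancel_of_le (rearrangement_le_maximalRearrangement (f := f)
        (μ := μ) ht2), mul_add, add_assoc]
    _ = _ := by
      rw [← add_mul, ENNReal.inv_two_add_inv_two, one_mul, add_assoc,
        tsub_add_cancel_of_le (rearrangement_antitone (by linarith))]

/-- Such `t` lie in `[m, 2m)` with `m = |{|f| > v}|`, and `1/t ≤ 1/m` there. This bounds how often a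
point is counted in the Tonelli argument for `p = q = 1`. -/
theorem lintegral_inv_indicator_rearrangement_le (v : ℝ≥0∞) :
    ∫⁻ t in Set.Ioi (0 : ℝ), {t | rearrangement μ f t < v ∧ v < rearrangement μ f (t / 2)}.indicator
      (fun t => (ENNReal.ofReal t)⁻¹) t ≤ 1 := by
  set m := μ {x | v < ‖f x‖ₑ}
  have hmem : ∀ t, 0 < t → (rearrangement μ f t < v ∧ v < rearrangement μ f (t / 2)) →
      m.toReal ≤ t ∧ t < 2 * m.toReal := by
    rintro t ht ⟨h1, h2⟩
    have h3 : m ≤ ENNReal.ofReal t := not_lt.1 fun h => h1.not_gt (lt_rearrangement_iff.2 h)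
    have hm : m ≠ ∞ := ne_top_of_le_ne_top ENNReal.ofReal_ne_top h3
    refine ⟨ENNReal.toReal_le_of_le_ofReal ht.le h3, ?_⟩
    have := (ENNReal.ofReal_lt_iff_lt_toReal (half_pos ht).le hm).1 (lt_rearrangement_iff.1 h2)
    linarith
  calc _ ≤ ∫⁻ t in Set.Ioi (0 : ℝ), (Set.Ico m.toReal (2 * m.toReal)).indicator
        (fun _ => (ENNReal.ofReal m.toReal)⁻¹) t := by
        refine setLIntegral_mono' measurableSet_Ioi fun t ht => ?_
        by_cases h : t ∈ {t | rearrangement μ f t < v ∧ v < rearrangement μ f (t / 2)}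
        · obtain ⟨h1, h2⟩ := hmem t ht h
          rw [Set.indicator_of_mem h, Set.indicator_of_mem (Set.mem_Ico.2 ⟨h1, h2⟩)]
          exact ENNReal.inv_le_inv.2 (ENNReal.ofReal_le_ofReal h1)
        · rw [Set.indicator_of_notMem h]
          exact bot_le
    _ ≤ ∫⁻ t, (Set.Ico m.toReal (2 * m.toReal)).indicator
        (fun _ => (ENNReal.ofReal m.toReal)⁻¹) t := setLIntegral_le_lintegral _ _
    _ = (ENNReal.ofReal m.toReal)⁻¹ * ENNReal.ofReal m.toReal := by
        rw [lintegral_indicator measurableSet_Ico, setLIntegral_const, Real.volume_Ico]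
        congr 2; ring
    _ ≤ 1 := ENNReal.inv_mul_le_one _

end Hardy

/-! ### From layers to norms of the gradient. -/

theorem norm_gradient {E : Type*} [NormedAddCommGroup E] [InnerProductSpace ℝ E] [CompleteSpace E]
    (f : E → ℝ) (x : E) : ‖gradient f x‖ = ‖fderiv ℝ f x‖ :=
  LinearIsometryEquiv.norm_map _ _

theorem enorm_norm_gradient {E : Type*} [NormedAddCommGroup E] [InnerProductSpace ℝ E]
    [CompleteSpace E] (f : E → ℝ) (x : E) : ‖‖gradient f x‖‖ₑ = ‖fderiv ℝ f x‖ₑ := by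
  rw [enorm_norm, ← ofReal_norm, norm_gradient, ofReal_norm]

theorem HasCompactSupport.exists_enorm_le {α E : Type*} [TopologicalSpace α] [NormedAddCommGroup E]
    {f : α → E} (hfc : HasCompactSupport f) (hf : Continuous f) :
    ∃ M : ℝ≥0∞, M ≠ ∞ ∧ ∀ x, ‖f x‖ₑ ≤ M := by
  obtain ⟨C, hC⟩ := hfc.exists_bound_of_continuous hf
  refine ⟨ENNReal.ofReal C, ENNReal.ofReal_ne_top, fun x => ?_⟩
  rw [← ofReal_norm]
  exact ENNReal.ofReal_le_ofReal (hC x)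

theorem HasCompactSupport.measure_support_ne_top {α E : Type*} [TopologicalSpace α]
    [MeasurableSpace α] {μ : Measure α} [IsFiniteMeasureOnCompacts μ] [Zero E] {f : α → E}
    (hfc : HasCompactSupport f) : μ (Function.support f) ≠ ∞ :=
  ne_top_of_le_ne_top hfc.isCompact.measure_lt_top.ne (measure_mono (subset_tsupport f))

section Gradient

variable {n : ℕ} {f : EuclideanSpace ℝ (Fin n) → ℝ}

theorem continuous_norm_gradient (hf : ContDiff ℝ 1 f) : Continuous fun x => ‖gradient f x‖ := by
  simp_rw [norm_gradient]
  exact (hf.continuous_fderiv one_ne_zero).norm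

theorem hasCompactSupport_norm_gradient (hfc : HasCompactSupport f) :
    HasCompactSupport fun x => ‖gradient f x‖ := by
  simp_rw [norm_gradient]
  exact (hfc.fderiv ℝ).norm

theorem rearrangement_sub_mul_rpow_le {C : ℝ≥0} {r t : ℝ} (hr : 0 ≤ r)
    (hC : ∀ s t : ℝ, 0 < s →
        (rearrangement volume f s - rearrangement volume f t) * ENNReal.ofReal s ^ r ≤
          C * ∫⁻ x in {x | rearrangement volume f t < ‖f x‖ₑ ∧ ‖f x‖ₑ < rearrangement volume f s},
            ‖fderiv ℝ f x‖ₑ) (ht : 0 < t) :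
    (rearrangement volume f (t / 2) - rearrangement volume f t) * ENNReal.ofReal t ^ r ≤
      2 ^ r * C * ∫⁻ x in {x | rearrangement volume f t < ‖f x‖ₑ ∧
        ‖f x‖ₑ < rearrangement volume f (t / 2)}, ‖fderiv ℝ f x‖ₑ := by
  have e : ENNReal.ofReal t ^ r = 2 ^ r * ENNReal.ofReal (t / 2) ^ r := by
    rw [← ENNReal.ofReal_ofNat, ← ENNReal.ofReal_mul_rpow zero_le_two hr, mul_div_cancel₀ t two_ne_zero]
  rw [e, mul_left_comm, mul_assoc]
  exact mul_le_mul_right (hC _ _ (half_pos ht)) _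

/-- Pointwise control of the dyadic oscillation of `f*` by the maximal average of `|∇ f|*`. -/
theorem rearrangement_sub_le_maximalRearrangement {C : ℝ≥0} {r t : ℝ} (hr : 0 ≤ r)
    (hC : ∀ s t : ℝ, 0 < s →
        (rearrangement volume f s - rearrangement volume f t) * ENNReal.ofReal s ^ r ≤
          C * ∫⁻ x in {x | rearrangement volume f t < ‖f x‖ₑ ∧ ‖f x‖ₑ < rearrangement volume f s},
            ‖fderiv ℝ f x‖ₑ)
    (hf : ContDiff ℝ 1 f) (hfc : HasCompactSupport f) (ht : 0 < t) :
    rearrangement volume f (t / 2) - rearrangement volume f t ≤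
      2 ^ r * C * (maximalRearrangement volume (fun x => ‖gradient f x‖) t *
        ENNReal.ofReal t ^ (1 - r)) := by
  have hg := continuous_norm_gradient hf
  obtain ⟨M, hM, hgM⟩ := (hasCompactSupport_norm_gradient hfc).exists_enorm_le hg
  have h0 : ENNReal.ofReal t ≠ 0 := by simpa using ht
  have h1 : ∫⁻ x in {x | rearrangement volume f t < ‖f x‖ₑ ∧
        ‖f x‖ₑ < rearrangement volume f (t / 2)}, ‖fderiv ℝ f x‖ₑ ≤
      maximalRearrangement volume (fun x => ‖gradient f x‖) t * ENNReal.ofReal t := by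
    rw [maximalRearrangement_mul ht]
    simp_rw [← enorm_norm_gradient]
    refine setLIntegral_enorm_le_lintegral_rearrangement hg.measurable hM hgM
      (le_trans (measure_mono fun x hx => ?_) (measure_rearrangement_lt_le (f := f) t))
    exact hx.1
  have h2 := (rearrangement_sub_mul_rpow_le hr hC ht).trans (mul_le_mul_right h1 _)
  have hr0 : ENNReal.ofReal t ^ r ≠ 0 :=
    (ENNReal.rpow_pos (pos_iff_ne_zero.2 h0) ENNReal.ofReal_ne_top).ne'
  have hrt : ENNReal.ofReal t ^ r ≠ ∞ := ENNReal.rpow_ne_top_of_nonneg hr ENNReal.ofReal_ne_top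
  refine (ENNReal.mul_le_mul_iff_left hr0 hrt).1 (h2.trans (le_of_eq ?_))
  rw [mul_assoc (2 ^ r * (C : ℝ≥0∞)), mul_assoc (maximalRearrangement _ _ _),
    ← ENNReal.rpow_add _ _ h0 ENNReal.ofReal_ne_top, sub_add_cancel, ENNReal.rpow_one]

/-- Integrating the increments of `f*` against `dt / t` recovers the full integral of `|∇ f|`. -/
theorem haarNorm_one_rearrangement_sub_le {C : ℝ≥0} {r : ℝ} (hr : 0 ≤ r)
    (hC : ∀ s t : ℝ, 0 < s →
        (rearrangement volume f s - rearrangement volume f t) * ENNReal.ofReal s ^ r ≤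
          C * ∫⁻ x in {x | rearrangement volume f t < ‖f x‖ₑ ∧ ‖f x‖ₑ < rearrangement volume f s},
            ‖fderiv ℝ f x‖ₑ)
    (hf : ContDiff ℝ 1 f) :
    haarNorm 1 (fun t => (rearrangement volume f (t / 2) - rearrangement volume f t) *
      ENNReal.ofReal t ^ r) ≤ 2 ^ r * C * ∫⁻ x, ‖fderiv ℝ f x‖ₑ := by
  have hF : Measurable (rearrangement volume f) := measurable_rearrangement
  have hfm : Measurable fun x => ‖f x‖ₑ := hf.continuous.measurable.enorm
  have hdf : Measurable fun x => ‖fderiv ℝ f x‖ₑ :=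
    (hf.continuous_fderiv one_ne_zero).measurable.enorm
  set S : Set (ℝ × EuclideanSpace ℝ (Fin n)) :=
    {z | rearrangement volume f z.1 < ‖f z.2‖ₑ ∧ ‖f z.2‖ₑ < rearrangement volume f (z.1 / 2)}
    with hS
  have hSm : MeasurableSet S := by
    have hfm' : Measurable fun z : ℝ × EuclideanSpace ℝ (Fin n) => ‖f z.2‖ₑ :=
      hfm.comp measurable_snd
    rw [hS, Set.ofPred_and]
    exact (measurableSet_lt (by fun_prop) hfm').inter (measurableSet_lt hfm' (by fun_prop))
  set H : ℝ → EuclideanSpace ℝ (Fin n) → ℝ≥0∞ := fun t x =>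
    S.indicator (fun z => ‖fderiv ℝ f z.2‖ₑ * (ENNReal.ofReal z.1)⁻¹) (t, x) with hH
  have hHm : Measurable (Function.uncurry H) :=
    Measurable.indicator (f := fun z : ℝ × EuclideanSpace ℝ (Fin n) =>
      ‖fderiv ℝ f z.2‖ₑ * (ENNReal.ofReal z.1)⁻¹) (by fun_prop) hSm
  have hcT : (2 : ℝ≥0∞) ^ r * C ≠ ∞ :=
    ENNReal.mul_ne_top (ENNReal.rpow_ne_top_of_nonneg hr (by simp)) ENNReal.coe_ne_top
  rw [haarNorm, if_neg ENNReal.one_ne_top]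
  simp only [ENNReal.toReal_one, ENNReal.rpow_one, div_one]
  calc _ ≤ ∫⁻ t in Set.Ioi (0 : ℝ), 2 ^ r * C * ∫⁻ x, H t x := by
        refine setLIntegral_mono' measurableSet_Ioi fun t ht => ?_
        refine (ENNReal.div_le_div_right (rearrangement_sub_mul_rpow_le hr hC ht) _).trans
          (le_of_eq ?_)
        have hSt : MeasurableSet {x | rearrangement volume f t < ‖f x‖ₑ ∧
            ‖f x‖ₑ < rearrangement volume f (t / 2)} := by
          rw [Set.ofPred_and]
          exact (measurableSet_lt (by fun_prop) (by fun_prop)).inter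
            (measurableSet_lt (by fun_prop) (by fun_prop))
        rw [mul_div_assoc, ← lintegral_indicator hSt, div_eq_mul_inv, ← lintegral_mul_const']
        · congr 1
          refine lintegral_congr fun x => ?_
          by_cases hx : x ∈ {x | rearrangement volume f t < ‖f x‖ₑ ∧
            ‖f x‖ₑ < rearrangement volume f (t / 2)}
          · have hx' : (t, x) ∈ S := hx
            rw [Set.indicator_of_mem hx, hH]
            simp only [Set.indicator_of_mem hx']
          · have hx' : (t, x) ∉ S := hx
            rw [Set.indicator_of_notMem hx, hH]
            simp only [Set.indicator_of_notMem hx', zero_mul]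
        · exact ENNReal.inv_ne_top.2 (by simpa using ht)
    _ = 2 ^ r * C * ∫⁻ x, ∫⁻ t in Set.Ioi (0 : ℝ), H t x := by
        rw [lintegral_const_mul' _ _ hcT, lintegral_lintegral_swap hHm.aemeasurable]
    _ ≤ _ := by
        refine mul_le_mul_right (lintegral_mono fun x => ?_) _
        calc _ = ∫⁻ t in Set.Ioi (0 : ℝ), ‖fderiv ℝ f x‖ₑ *
              {t | rearrangement volume f t < ‖f x‖ₑ ∧
                ‖f x‖ₑ < rearrangement volume f (t / 2)}.indicator
              (fun t => (ENNReal.ofReal t)⁻¹) t := by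
              refine lintegral_congr fun t => ?_
              by_cases hx : t ∈ {t | rearrangement volume f t < ‖f x‖ₑ ∧
                ‖f x‖ₑ < rearrangement volume f (t / 2)}
              · have hx' : (t, x) ∈ S := hx
                rw [Set.indicator_of_mem hx, hH]
                simp only [Set.indicator_of_mem hx']
              · have hx' : (t, x) ∉ S := hx
                rw [Set.indicator_of_notMem hx, hH]
                simp only [Set.indicator_of_notMem hx', mul_zero]
          _ ≤ ‖fderiv ℝ f x‖ₑ * 1 := by
              rw [lintegral_const_mul' _ _ enorm_ne_top]
              exact mul_le_mul_right (lintegral_inv_indicator_rearrangement_le _) _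
          _ = _ := mul_one _

/-- Hardy–Littlewood on the whole support of the gradient; the weight `t` cancels `dt/t`. -/
theorem lintegral_enorm_fderiv_le_haarNorm (hf : ContDiff ℝ 1 f) (hfc : HasCompactSupport f) :
    ∫⁻ x, ‖fderiv ℝ f x‖ₑ ≤ haarNorm 1 (fun t =>
      rearrangement volume (fun x => ‖gradient f x‖) t * ENNReal.ofReal t ^ (1 : ℝ)) := by
  have hg := continuous_norm_gradient hf
  have hgc := hasCompactSupport_norm_gradient hfc
  obtain ⟨M, hM, hgM⟩ := hgc.exists_enorm_le hg
  set g := fun x => ‖gradient f x‖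
  have hs : volume (Function.support g) ≠ ∞ := hgc.measure_support_ne_top
  rw [haarNorm, if_neg ENNReal.one_ne_top]
  simp only [ENNReal.toReal_one, ENNReal.rpow_one, div_one]
  calc ∫⁻ x, ‖fderiv ℝ f x‖ₑ = ∫⁻ x in Function.support g, ‖g x‖ₑ := by
        simp_rw [← enorm_norm_gradient]
        refine (setLIntegral_eq_of_support_subset ?_).symm
        intro x hx hgx
        exact hx (by change ‖g x‖ₑ = 0; rw [hgx, enorm_zero])
    _ ≤ ∫⁻ s in Set.Ioo 0 (volume (Function.support g)).toReal, rearrangement volume g s :=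
        setLIntegral_enorm_le_lintegral_rearrangement hg.measurable hM hgM
          (ENNReal.ofReal_toReal hs).ge
    _ ≤ ∫⁻ s in Set.Ioi 0, rearrangement volume g s := lintegral_mono_set Set.Ioo_subset_Ioi_self
    _ = _ := setLIntegral_congr_fun measurableSet_Ioi fun t ht =>
        (ENNReal.mul_div_cancel_right (by simpa using ht) ENNReal.ofReal_ne_top).symm

end Gradient

/-! ### Assembly of the cases. -/

theorem theorem1 (n : ℕ) (hn : 1 < n) (p q pbar : ℝ≥0∞)
    (hp1 : 1 ≤ p) (hpn : p ≤ (n : ℝ≥0∞)) (hq : 1 ≤ q)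
    (hpbar : pbar⁻¹ = p⁻¹ - (n : ℝ≥0∞)⁻¹)
    (hpq : 1 < p ∨ (p = 1 ∧ q = 1)) :
    ∃ c : ℝ≥0, ∀ f : EuclideanSpace ℝ (Fin n) → ℝ,
      ContDiff ℝ ((⊤ : ℕ∞) : WithTop ℕ∞) f → HasCompactSupport f →
        lorentzNorm pbar q volume f
          ≤ (c : ℝ≥0∞) * lorentzNorm p q volume (fun x => ‖gradient f x‖) := by
  obtain ⟨C, hC⟩ := exists_const_rearrangement_sub_le hn
  have hn1 : (1 : ℝ) < n := by exact_mod_cast hn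
  have hn0 : (0 : ℝ) < n := by positivity
  have hnt : (n : ℝ≥0∞) ≠ ∞ := ENNReal.natCast_ne_top n
  have hpt : p ≠ ∞ := ne_top_of_le_ne_top hnt hpn
  set r : ℝ := 1 - 1 / (n : ℝ) with hr_def
  have hr : 0 ≤ r := by
    rw [hr_def, sub_nonneg, div_le_one hn0]; exact hn1.le
  set a : ℝ := 1 / p.toReal with ha_def
  have ha0 : 0 ≤ a := by positivity
  set A : ℝ≥0∞ := 2 ^ r * C with hA_def
  have hA : A ≠ ∞ := ENNReal.mul_ne_top (ENNReal.rpow_ne_top_of_nonneg hr (by simp)) (by simp)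
  suffices h : ∃ K : ℝ≥0∞, K ≠ ∞ ∧ ∀ f : EuclideanSpace ℝ (Fin n) → ℝ,
      ContDiff ℝ 1 f → HasCompactSupport f →
        lorentzNorm pbar q volume f ≤ K * haarNorm q (fun t =>
          rearrangement volume (fun x => ‖gradient f x‖) t * ENNReal.ofReal t ^ a) by
    obtain ⟨K, hK, h⟩ := h
    refine ⟨K.toNNReal, fun f hf hfc => ?_⟩
    rw [ENNReal.coe_toNNReal hK, lorentzNorm.eq_1 p, if_neg hpt]
    exact h f (hf.of_le (by exact_mod_cast le_top)) hfc
  -- Hardy's constant, infinite at `a = 1`; finiteness is therefore proved only under `1 < p`.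
  set B : ℝ≥0∞ := (1 - 2 ^ a * 2⁻¹)⁻¹ * (2 ^ a * 2⁻¹) with hB_def
  have hhardy : 1 < p → B ≠ ∞ ∧ ∀ f : EuclideanSpace ℝ (Fin n) → ℝ,
      ContDiff ℝ 1 f → HasCompactSupport f →
        haarNorm q (fun t => maximalRearrangement volume (fun x => ‖gradient f x‖) t *
          ENNReal.ofReal t ^ a) ≤ B * haarNorm q (fun t =>
            rearrangement volume (fun x => ‖gradient f x‖) t * ENNReal.ofReal t ^ a) := by
    intro hp
    have ha1 : a < 1 := by
      have : 1 < p.toReal := by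
        rw [← ENNReal.toReal_one]; exact (ENNReal.toReal_lt_toReal (by simp) hpt).2 hp
      rw [ha_def, div_lt_one (by linarith)]; exact this
    have h2a : (2 : ℝ≥0∞) ^ a * 2⁻¹ < 1 := by
      rw [← ENNReal.rpow_neg_one, ← ENNReal.rpow_add _ _ (by simp) (by simp)]
      exact ENNReal.rpow_lt_one_of_one_lt_of_neg (by norm_num) (by linarith)
    refine ⟨ENNReal.mul_ne_top (ENNReal.inv_ne_top.2 (tsub_pos_of_lt h2a).ne') h2a.ne_top,
      fun f hf hfc => ?_⟩
    have hgc := hasCompactSupport_norm_gradient hfc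
    obtain ⟨M, hM, hgM⟩ := hgc.exists_enorm_le (continuous_norm_gradient hf)
    rw [hB_def, mul_assoc]
    exact haarNorm_maximalRearrangement_le hq hM hgM hgc.measure_support_ne_top ha0 ha1
  have hsub : ∀ f : EuclideanSpace ℝ (Fin n) → ℝ, ContDiff ℝ 1 f → HasCompactSupport f →
      ∀ b, b + 1 / (n : ℝ) = a →
        haarNorm q (fun t => (rearrangement volume f (t / 2) - rearrangement volume f t) *
          ENNReal.ofReal t ^ b) ≤
        A * haarNorm q (fun t => maximalRearrangement volume (fun x => ‖gradient f x‖) t *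
          ENNReal.ofReal t ^ a) := by
    intro f hf hfc b hb
    have hG : Measurable (maximalRearrangement volume (fun x => ‖gradient f x‖)) :=
      measurable_maximalRearrangement
    rw [← haarNorm_const_mul hq (by fun_prop)]
    refine haarNorm_mono fun t ht => ?_
    refine (mul_le_mul_left (rearrangement_sub_le_maximalRearrangement hr (hC f hf hfc)
      hf hfc ht) _).trans (le_of_eq ?_)
    rw [mul_assoc, mul_assoc (maximalRearrangement _ _ _), ← ENNReal.rpow_add _ _ (by simpa using ht) ENNReal.ofReal_ne_top]
    -- Exponents match: `(1 - r) + b = 1/n + b = a`.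
    congr 4
    rw [← hb, hr_def]; ring
  by_cases hpb : pbar = ∞
  · have hpn' : p = n := by
      -- Subtraction is truncated, so this gives only `n ≤ p`; the hypothesis `p ≤ n` supplies the
      -- rest.
      rw [hpb, ENNReal.inv_top, eq_comm, tsub_eq_zero_iff_le, ENNReal.inv_le_inv] at hpbar
      exact le_antisymm hpn hpbar
    have hp : 1 < p := by rw [hpn']; exact_mod_cast hn
    obtain ⟨hB, hH⟩ := hhardy hp
    refine ⟨2 * (A * B), by finiteness, fun f hf hfc => ?_⟩
    obtain ⟨M, hM, hfM⟩ := hfc.exists_enorm_le hf.continuous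
    rw [lorentzNorm, if_pos hpb, mul_assoc, mul_assoc]
    have h1 := hsub f hf hfc 0 (by rw [ha_def, hpn']; simp)
    simp only [ENNReal.rpow_zero, mul_one] at h1
    refine (haarNorm_maximalRearrangement_sub_le hq hM hfM).trans ?_
    exact mul_le_mul_right (h1.trans (mul_le_mul_right (hH f hf hfc) _)) _
  · set b : ℝ := 1 / pbar.toReal with hb_def
    have hba : b + 1 / (n : ℝ) = a := by
      have h1 := congrArg ENNReal.toReal hpbar
      rw [ENNReal.toReal_sub_of_le (ENNReal.inv_le_inv.2 hpn)
        (ENNReal.inv_ne_top.2 (one_pos.trans_le hp1).ne')] at h1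
      simp only [ENNReal.toReal_inv, ENNReal.toReal_natCast] at h1
      rw [hb_def, ha_def, one_div, one_div, one_div, h1]; ring
    have hb : 0 < b := by
      have : 0 < pbar.toReal := by
        refine ENNReal.toReal_pos (fun h => ?_) hpb
        rw [h, ENNReal.inv_zero] at hpbar
        exact ENNReal.sub_ne_top (ENNReal.inv_ne_top.2 (one_pos.trans_le hp1).ne') hpbar.symm
      positivity
    have h1b : (1 : ℝ≥0∞) < 2 ^ b := ENNReal.one_lt_rpow (by norm_num) hb
    set D : ℝ≥0∞ := (1 - (2 ^ b)⁻¹)⁻¹ * (2 ^ b)⁻¹ with hD_def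
    have hD : D ≠ ∞ := ENNReal.mul_ne_top
      (ENNReal.inv_ne_top.2 (tsub_pos_of_lt (ENNReal.inv_lt_one.2 h1b)).ne')
      (ENNReal.inv_ne_top.2 (zero_lt_one.trans h1b).ne')
    have hpot : ∀ f : EuclideanSpace ℝ (Fin n) → ℝ, ContDiff ℝ 1 f → HasCompactSupport f →
        lorentzNorm pbar q volume f ≤ D * haarNorm q (fun t =>
          (rearrangement volume f (t / 2) - rearrangement volume f t) * ENNReal.ofReal t ^ b) := by
      intro f hf hfc
      obtain ⟨M, hM, hfM⟩ := hfc.exists_enorm_le hf.continuous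
      rw [lorentzNorm, if_neg hpb, hD_def, mul_assoc]
      exact haarNorm_rearrangement_le hq hM hfM hfc.measure_support_ne_top hb
    rcases hpq with hp | ⟨hp, rfl⟩
    · obtain ⟨hB, hH⟩ := hhardy hp
      refine ⟨D * (A * B), by finiteness, fun f hf hfc => (hpot f hf hfc).trans ?_⟩
      rw [mul_assoc D, mul_assoc A]
      exact mul_le_mul_right ((hsub f hf hfc b hba).trans (mul_le_mul_right (hH f hf hfc) _)) _
    · refine ⟨D * A, by finiteness, fun f hf hfc => (hpot f hf hfc).trans ?_⟩
      have ha : a = 1 := by rw [ha_def, hp]; simp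
      -- At `p = 1` the weight `t^b` is exactly the one in the layer estimate, so `|∇f|**` is
      -- bypassed.
      have hbr : b = r := by rw [hr_def]; linarith
      rw [mul_assoc D, ha, hbr]
      exact mul_le_mul_right ((haarNorm_one_rearrangement_sub_le hr (hC f hf hfc) hf).trans
        (mul_le_mul_right (lintegral_enorm_fderiv_le_haarNorm hf hfc) _)) _
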